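/- Let $g,d\ge 0$ be integers and let $\mathcal H_g$ be the Siegel upper half space of symmetric complex $g\times g$ matrices with positive definite imaginary part. For $\tau\in\mathcal H_g$, $z\in\mathbf C^g$ and $\sigma\in\{0,1\}^g=(\mathbf Z/2\mathbf Z)^g$ let $$\Theta[\sigma](\tau,z)=\sum_{n\in\mathbf Z^g}\exp\big[2\pi i\,(n+\sigma/2)\,\tau\;{}^t(n+\sigma/2)+4\pi i\,(n+\sigma/2)\;{}^tz\big]$$ be the second order theta functions, and put $\Theta_\tau(z)=(\Theta[\sigma](\tau,z))_\sigma\in\mathbf C^{2^g}$. The universal Kummer variety $\mathcal K_g(2,4)$ is the (Zariski) closure in $\mathbf P^{2^g-1}\times\mathbf P^{2^g-1}$ of the image of the map $\mathcal H_g\times\mathbf C^g\to\mathbf P^{2^g-1}\times\mathbf P^{2^g-1}$, $(\tau,z)\mapsto(\Theta_\tau(0),\Theta_\tau(z))$. An equation for $\mathcal K_g(2,4)$ is an element of its ideal $\mathcal I_g\subset\mathbf C[\mathbf u,\mathbf x]$, that is, a polynomial in the variables $u_\sigma,x_\sigma$, $\sigma\in(\mathbf Z/2\mathbf Z)^g$,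 which vanishes on $\mathcal K_g(2,4)$. For a subgroup $T=\{0,\alpha,\beta,\alpha+\beta\}$ of $(\mathbf Z/2\mathbf Z)^g$ of order at most four (with $\alpha=\beta=0$ if $T=\{0\}$, and $\beta=0$ if $T=\{0,\alpha\}$) let $$P_T(\mathbf x)=\sum_{\rho\in(\mathbf Z/2\mathbf Z)^g}x_\rho\, x_{\rho+\alpha}\, x_{\rho+\beta}\, x_{\rho+\alpha+\beta}\in\mathbf C[\mathbf x].$$ Let $\mathbf C[\mathbf p]$ be the polynomial ring in variables $p_T$, one for each such $T$. Let $R\in\mathbf C[\mathbf p]$ be a generalized Igusa equation of degree $d$, i.e. a homogeneous polynomial of degree $d$ with $R(\ldots,P_T(\mathbf x),\ldots)=0$ in $\mathbf C[\mathbf x]$, and put $$F_R(\mathbf u,\mathbf x)=\sum_T\frac{\partial R}{\partial p_T}(\ldots,P_S(\mathbf u),\ldots)\,P_T(\mathbf x)\in\mathbf C[\mathbf u,\mathbf x].$$ Then every monomial of $F_R$ has degree $4(d-1)$ in the $u_\sigma$ and degree $4$ in the $x_\sigma$ (for $d=0$ one has $R=0$ and $F_R=0$), and $F_R$ is an equation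 for the universal Kummer variety $\mathcal K_g(2,4)$; more precisely, $F_R\in\mathcal I_g$, and $F_R(\Theta_\tau(0),\Theta_\tau(z))=0$ for all $\tau\in\mathcal H_g$ and $z\in\mathbf C^g$. Moreover $F_R(\mathbf u,\mathbf u)=0$ in $\mathbf C[\mathbf u]$. -/

import Mathlib

open scoped LinearAlgebra.Projectivization

noncomputable section

namespace UniversalKummer

/-! ### Second order theta functions -/

/-- The group `(ℤ/2ℤ)^g`. Its elements are also used as theta characteristics in `{0,1}^g`,
through the representatives `0, 1`. -/
abbrev Two (g : ℕ) : Type := Fin g → ZMod 2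

/-- The Siegel upper half space `ℋ_g`: symmetric complex `g × g` matrices with positive definite
imaginary part. -/
def SiegelUpperHalfSpace (g : ℕ) : Set (Matrix (Fin g) (Fin g) ℂ) :=
  {τ | τ.IsSymm ∧ (τ.map Complex.im).PosDef}

/-- The vector `ε / 2 ∈ ℂ^g` for a characteristic `ε ∈ {0,1}^g`. -/
def halfChar {g : ℕ} (ε : Two g) : Fin g → ℂ := fun i => ((ε i).val : ℂ) / 2

/-- The classical theta function with characteristics
`θ[ε, ε'](τ, z) = ∑_{n ∈ ℤ^g} exp (π i (n + ε/2) τ ᵗ(n + ε/2) + 2 π i (n + ε/2) ᵗ(z + ε'/2))`.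
(The series converges absolutely for `τ ∈ ℋ_g`.) -/
def theta {g : ℕ} (ε ε' : Two g) (τ : Matrix (Fin g) (Fin g) ℂ) (z : Fin g → ℂ) : ℂ :=
  ∑' n : Fin g → ℤ,
    let v : Fin g → ℂ := (fun i => (n i : ℂ)) + halfChar ε
    Complex.exp (Real.pi * Complex.I * (v ⬝ᵥ τ.mulVec v) +
      2 * Real.pi * Complex.I * (v ⬝ᵥ (z + halfChar ε')))

/-- The vector `Θ_τ(z)` of second order theta functions `Θ[σ](τ, z) = θ[σ, 0](2τ, 2z)`,
`σ ∈ (ℤ/2ℤ)^g`. -/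
def secondTheta {g : ℕ} (τ : Matrix (Fin g) (Fin g) ℂ) (z : Fin g → ℂ) : Two g → ℂ :=
  fun σ => theta σ 0 ((2 : ℂ) • τ) ((2 : ℂ) • z)

/-! ### The universal Kummer variety -/

/-- The projective space `P^{2^g - 1}` with homogeneous coordinates indexed by `(ℤ/2ℤ)^g`. -/
abbrev PSpace (g : ℕ) : Type := ℙ ℂ (Two g → ℂ)

/-- The ring `ℂ[x]` in the variables `x_σ`, `σ ∈ (ℤ/2ℤ)^g` (it also serves as `ℂ[u]`). -/
abbrev Poly (g : ℕ) : Type := MvPolynomial (Two g) ℂ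

/-- The ring `ℂ[u, x]`; the variable `u_σ` is `X (Sum.inl σ)` and `x_σ` is `X (Sum.inr σ)`. -/
abbrev BiPoly (g : ℕ) : Type := MvPolynomial (Two g ⊕ Two g) ℂ

/-- `F ∈ ℂ[u, x]` is bihomogeneous of bidegree `(a, b)`: every monomial of `F` has degree `a` in
the `u_σ` and degree `b` in the `x_σ`. -/
def IsBihomogeneous {g : ℕ} (F : BiPoly g) (a b : ℕ) : Prop :=
  MvPolynomial.IsWeightedHomogeneous
    (Sum.elim (fun _ => ((1, 0) : ℕ × ℕ)) (fun _ => ((0, 1) : ℕ × ℕ))) F (a, b)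

/-- The value `F(u, x)`. -/
def biEval {g : ℕ} (u x : Two g → ℂ) (F : BiPoly g) : ℂ :=
  MvPolynomial.eval (Sum.elim u x) F

/-- `F` vanishes at a point of `P × P`, i.e. at all choices of homogeneous coordinates of it. -/
def VanishesAt {g : ℕ} (F : BiPoly g) (p : PSpace g × PSpace g) : Prop :=
  ∀ (u x : Two g → ℂ) (hu : u ≠ 0) (hx : x ≠ 0),
    Projectivization.mk ℂ u hu = p.1 → Projectivization.mk ℂ x hx = p.2 → biEval u x F = 0

/-- The Zariski topology on `P^{2^g - 1} × P^{2^g - 1}`: the closed sets are the intersections of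
zero sets of bihomogeneous polynomials. -/
@[reducible]
def zariskiTopology (g : ℕ) : TopologicalSpace (PSpace g × PSpace g) :=
  TopologicalSpace.generateFrom
    {U | ∃ (F : BiPoly g) (a b : ℕ), IsBihomogeneous F a b ∧ U = {p | ¬ VanishesAt F p}}

/-- The image of the map `Θ : (τ, z) ↦ (Θ_τ(0), Θ_τ(z))` from `ℋ_g × ℂ^g` to `P × P`.
(For `τ ∈ ℋ_g` the second order theta functions have no common zero, so the two conditions
`≠ 0` hold at every `(τ, z)`.) -/
def thetaImage (g : ℕ) : Set (PSpace g × PSpace g) :=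
  {p | ∃ τ ∈ SiegelUpperHalfSpace g, ∃ (z : Fin g → ℂ)
    (h₀ : secondTheta τ 0 ≠ 0) (h : secondTheta τ z ≠ 0),
    p = (Projectivization.mk ℂ (secondTheta τ 0) h₀, Projectivization.mk ℂ (secondTheta τ z) h)}

/-- The universal Kummer variety `𝒦_g(2,4)`: the closure of the image of `Θ`. -/
def universalKummer (g : ℕ) : Set (PSpace g × PSpace g) :=
  @closure _ (zariskiTopology g) (thetaImage g)

/-- The ideal `ℐ_g ⊆ ℂ[u, x]` of the universal Kummer variety. Its elements are the equations for
the universal Kummer variety. -/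
def universalKummerIdeal (g : ℕ) : Ideal (BiPoly g) where
  carrier := {F | ∀ p ∈ universalKummer g, VanishesAt F p}
  zero_mem' := by
    intro p _ u x hu hx _ _
    simp [biEval]
  add_mem' := by
    intro F G hF hG p hp u x hu hx h1 h2
    have e1 := hF p hp u x hu hx h1 h2
    have e2 := hG p hp u x hu hx h1 h2
    simp only [biEval] at e1 e2 ⊢
    rw [map_add, e1, e2, add_zero]
  smul_mem' := by
    intro c F hF p hp u x hu hx h1 h2
    have e1 := hF p hp u x hu hx h1 h2
    simp only [biEval] at e1 ⊢
    rw [smul_eq_mul, map_mul, e1, mul_zero]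

/-! ### Heisenberg invariant quartics and generalized Igusa equations -/

/-- The set of subgroups `T ⊆ (ℤ/2ℤ)^g` of order at most four. -/
abbrev SmallSubgroup (g : ℕ) : Type := {T : AddSubgroup (Two g) // Nat.card T ≤ 4}

instance (g : ℕ) : Fintype (SmallSubgroup g) := Fintype.ofFinite _

open Classical in
/-- The Heisenberg invariant quartic
`P_T = ∑_ρ x_ρ x_{ρ+α} x_{ρ+β} x_{ρ+α+β}` for `T = {0, α, β, α + β}`. As each element of `T` occurs
`4 / |T|` times in the list `0, α, β, α + β`, the summand is `∏_{t ∈ T} x_{ρ+t}^{4/|T|}`; see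
`quartic_eq`. -/
def quartic {g : ℕ} (T : SmallSubgroup g) : Poly g :=
  ∑ ρ : Two g, ∏ t : T.1, MvPolynomial.X (ρ + (t : Two g)) ^ (4 / Nat.card T.1)

theorem quartic_eq {g : ℕ} (T : SmallSubgroup g) (α β : Two g)
    (hT : (T.1 : Set (Two g)) = {0, α, β, α + β}) :
    quartic T = ∑ ρ : Two g, (MvPolynomial.X ρ * MvPolynomial.X (ρ + α) * MvPolynomial.X (ρ + β) *
      MvPolynomial.X (ρ + α + β) : Poly g) := by
  classical
  have hs : ∀ t : Two g, t ∈ ({0, α, β, α + β} : Finset (Two g)) ↔ t ∈ T.1 := by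
    intro t
    have h := Set.ext_iff.1 hT t
    simpa using h.symm
  have hc : Nat.card T.1 = ({0, α, β, α + β} : Finset (Two g)).card := by
    rw [Nat.card_eq_fintype_card]
    exact Fintype.card_of_subtype _ hs
  have hself : ∀ v : Two g, v + v = 0 := fun v => by
    funext i
    exact CharTwo.add_self_eq_zero (v i)
  have hne : ∀ v w : Two g, v + w = 0 → v = w := fun v w h => by
    have := congrArg (· + w) h
    simpa [add_assoc, hself w] using this
  unfold quartic
  refine Finset.sum_congr rfl fun ρ _ => ?_
  rw [← Finset.prod_subtype (F := inferInstance) ({0, α, β, α + β} : Finset (Two g)) hs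
    (fun t => (MvPolynomial.X (ρ + t) : Poly g) ^ (4 / Nat.card T.1)), hc]
  by_cases hα : α = 0
  · subst hα
    by_cases hβ : β = 0
    · subst hβ
      simp
      ring
    · have h0 : (0 : Two g) ≠ β := fun h => hβ h.symm
      simp [h0]
      ring
  · have h0α : (0 : Two g) ≠ α := fun h => hα h.symm
    by_cases hβ : β = 0
    · subst hβ
      simp [h0α]
      ring
    · have h0β : (0 : Two g) ≠ β := fun h => hβ h.symm
      by_cases hαβ : α = β
      · subst hαβ
        simp only [hself, add_assoc, add_zero]
        rw [show ({0, α, α, 0} : Finset (Two g)) = {0, α} by ext; simp; tauto]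
        simp [h0α]
        ring
      · have h4 : (0 : Two g) ≠ α + β := fun h => hαβ (hne _ _ h.symm)
        rw [Finset.card_insert_of_notMem (by simp [h0α, h0β, h4]),
          Finset.card_insert_of_notMem (by simp [hαβ, hβ]),
          Finset.card_insert_of_notMem (by simp [hα]),
          Finset.prod_insert (by simp [h0α, h0β, h4]),
          Finset.prod_insert (by simp [hαβ, hβ]),
          Finset.prod_insert (by simp [hα])]
        simp [add_assoc, mul_assoc]

/-- The ring `ℂ[p]` in the variables `p_T`. -/
abbrev PPoly (g : ℕ) : Type := MvPolynomial (SmallSubgroup g) ℂ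

/-- The evaluation map `x^* : ℂ[p] → ℂ[x]`, `p_T ↦ P_T(x)` (it also serves as `u^*`). -/
def evalQuartics (g : ℕ) : PPoly g →ₐ[ℂ] Poly g := MvPolynomial.aeval quartic

/-- A generalized Igusa equation of degree `d` in dimension `g`: a homogeneous polynomial
`R ∈ ℂ[p]` of degree `d` with `x^*(R) = 0`. -/
def IsGeneralizedIgusaEquation (g d : ℕ) (R : PPoly g) : Prop :=
  R.IsHomogeneous d ∧ evalQuartics g R = 0

/-- `F_R(u, x) = ∑_T u^*(∂R/∂p_T) P_T(x)`. -/
def igusaForm {g : ℕ} (R : PPoly g) : BiPoly g :=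
  ∑ T : SmallSubgroup g,
    MvPolynomial.rename Sum.inl (evalQuartics g (MvPolynomial.pderiv T R)) *
      MvPolynomial.rename Sum.inr (quartic T)

/-- The substitution `x := u`, i.e. `F(u, x) ↦ F(u, u) ∈ ℂ[u]`. -/
def restrictDiagonal {g : ℕ} (F : BiPoly g) : Poly g :=
  MvPolynomial.rename (Sum.elim id id) F

end UniversalKummer

end

/-! ### Polynomial generalities: degrees and the chain rule. -/

namespace MvPolynomial

variable {R σ τ : Type*} [CommRing R]

/-! The quartic Riemann relation `sum_secondTheta_quartic` says that `P_T(Θ(z))` is a quarter of the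
derivative of `P_T` at `u = Θ(0)` in the direction `y = Θ(2z)`. By the chain rule, `4 F_R(u, Θ(z))`
is then the derivative of `R(…, P_T, …)` at `u` along `y`, and this vanishes because that composite
is the zero polynomial (`biEval_igusaForm_eq_zero`). The Riemann relation itself comes from an
orthogonal involution of quadruples of lattice vectors. On the diagonal, Euler's identity gives
`F_R(u, u) = d R(…, P_T(u), …) = 0`. -/

theorem IsHomogeneous.isWeightedHomogeneous_rename {M : Type*} [AddCommMonoid M]
    {p : MvPolynomial σ R} {n : ℕ} (hp : p.IsHomogeneous n) (f : σ → τ) (w : τ → M) (m : M)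
    (hw : ∀ i, w (f i) = m) : (rename f p).IsWeightedHomogeneous w (n • m) := by
  intro d hd
  obtain ⟨u, rfl, hu⟩ := coeff_rename_ne_zero f p d hd
  have h : ∑ i ∈ u.support, u i = n := by
    by_contra h
    exact hu (hp.coeff_eq_zero h)
  rw [Finsupp.weight_apply, Finsupp.sum_mapDomain_index (by simp) (by simp [add_smul]), ← h,
    Finset.sum_smul]
  exact Finset.sum_congr rfl fun i _ => congrArg (u i • ·) (hw i)

theorem derivation_aeval_eq_sum [Fintype σ] (D : Derivation R (MvPolynomial τ R) (MvPolynomial τ R))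
    (f : σ → MvPolynomial τ R) (p : MvPolynomial σ R) :
    D (aeval f p) = ∑ i, aeval f (pderiv i p) * D (f i) := by
  classical
  induction p using MvPolynomial.induction_on with
  | C a =>
    simp
  | add p q hp hq => simp only [map_add, hp, hq, add_mul, Finset.sum_add_distrib]
  | mul_X p i hp =>
    simp only [map_mul, aeval_X, Derivation.leibniz, hp, smul_eq_mul, map_add, add_mul,
      Finset.sum_add_distrib, Finset.mul_sum, pderiv_X]
    congr 1
    · rw [Finset.sum_eq_single i]
      · simp
      · intro j _ hj
        simp [hj.symm]
      · simp
    · exact Finset.sum_congr rfl fun j _ => by ring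

end MvPolynomial

/-! ### Algebra of `F_R`: bidegree, diagonal, and a criterion for vanishing. -/

namespace UniversalKummer

open MvPolynomial

variable {g : ℕ}

theorem two_add_self (v : Two g) : v + v = 0 := by
  funext i
  exact CharTwo.add_self_eq_zero (v i)

theorem exists_generators (T : SmallSubgroup g) :
    ∃ α β : Two g, (T.1 : Set (Two g)) = {0, α, β, α + β} := by
  classical
  obtain ⟨T, hT⟩ := T
  by_cases h0 : ∀ t ∈ T, t = 0
  · refine ⟨0, 0, Set.ext fun t => ?_⟩
    constructor
    · intro ht
      simp [h0 t ht]
    · intro ht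
      have : t = 0 := by simpa using ht
      simp [this]
  push Not at h0
  obtain ⟨α, hα, hα0⟩ := h0
  by_cases h1 : ∀ t ∈ T, t = 0 ∨ t = α
  · refine ⟨α, 0, Set.ext fun t => ?_⟩
    constructor
    · intro ht
      rcases h1 t ht with rfl | rfl <;> simp
    · intro ht
      have : t = 0 ∨ t = α := by
        simp only [Set.mem_insert_iff, Set.mem_singleton_iff, add_zero] at ht
        tauto
      rcases this with rfl | rfl
      · exact T.zero_mem
      · exact hα
  push Not at h1
  obtain ⟨β, hβ, hβ0, hβα⟩ := h1
  refine ⟨α, β, ?_⟩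
  have hsum : α + β ≠ 0 := fun h => hβα (by
    have := congrArg (α + ·) h
    simpa [← add_assoc, two_add_self] using this)
  symm
  refine Set.eq_of_subset_of_ncard_le ?_ ?_ (Set.toFinite _)
  · rintro t (rfl | rfl | rfl | rfl)
    · exact T.zero_mem
    · exact hα
    · exact hβ
    · exact T.add_mem hα hβ
  · have h4 : ({0, α, β, α + β} : Set (Two g)).ncard = 4 := by
      rw [Set.ncard_eq_toFinset_card']
      simp only [Set.toFinset_insert, Set.toFinset_singleton]
      rw [Finset.card_insert_of_notMem (by simp [hα0.symm, hβ0.symm, hsum.symm]),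
        Finset.card_insert_of_notMem (by simp [hβα.symm, hβ0]),
        Finset.card_insert_of_notMem (by simp [hα0]), Finset.card_singleton]
    rw [h4]
    exact hT

theorem quartic_isHomogeneous (T : SmallSubgroup g) : (quartic T).IsHomogeneous 4 := by
  obtain ⟨α, β, h⟩ := exists_generators T
  rw [quartic_eq T α β h]
  exact IsHomogeneous.sum _ _ _ fun ρ _ =>
    (((isHomogeneous_X ℂ ρ).mul (isHomogeneous_X ℂ _)).mul (isHomogeneous_X ℂ _)).mul
      (isHomogeneous_X ℂ _)

theorem igusaForm_isBihomogeneous {d : ℕ} {R : PPoly g} (hR : R.IsHomogeneous d) :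
    IsBihomogeneous (igusaForm R) (4 * (d - 1)) 4 := by
  refine IsWeightedHomogeneous.sum _ _ _ fun T _ => ?_
  -- For `d = 0` the truncated `d - 1` is harmless, since the derivatives of a constant vanish.
  have h := ((hR.pderiv (i := T)).aeval quartic
    (fun S => quartic_isHomogeneous S)).isWeightedHomogeneous_rename Sum.inl
    (Sum.elim (fun _ : Two g => ((1, 0) : ℕ × ℕ)) (fun _ : Two g => ((0, 1) : ℕ × ℕ))) (1, 0)
    (fun _ => rfl)
  have h' := (quartic_isHomogeneous T).isWeightedHomogeneous_rename Sum.inr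
    (Sum.elim (fun _ : Two g => ((1, 0) : ℕ × ℕ)) (fun _ : Two g => ((0, 1) : ℕ × ℕ))) (0, 1)
    (fun _ => rfl)
  have hm := h.mul h'
  simp only [Prod.smul_mk, Prod.mk_add_mk, smul_eq_mul, mul_zero, mul_one, add_zero,
    zero_add] at hm
  exact hm

/-- Euler's identity for `R`, pulled back along the quartics. -/
theorem restrictDiagonal_igusaForm {d : ℕ} {R : PPoly g} (hR : R.IsHomogeneous d)
    (h0 : evalQuartics g R = 0) : restrictDiagonal (igusaForm R) = 0 := by
  have h : restrictDiagonal (igusaForm R) = evalQuartics g (∑ T, X T * pderiv T R) := by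
    have hid : (Sum.elim id id ∘ Sum.inl : Two g → Two g) = id := rfl
    have hid' : (Sum.elim id id ∘ Sum.inr : Two g → Two g) = id := rfl
    simp only [restrictDiagonal, igusaForm, map_sum, map_mul, rename_rename, hid, hid', rename_id,
      AlgHom.id_apply]
    exact Finset.sum_congr rfl fun T _ => by rw [mul_comm]; simp [evalQuartics]
  rw [h, hR.sum_X_mul_pderiv, map_nsmul, h0, smul_zero]

theorem biEval_igusaForm (u x : Two g → ℂ) (R : PPoly g) :
    biEval u x (igusaForm R) =
      ∑ T, eval u (evalQuartics g (pderiv T R)) * eval x (quartic T) := by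
  simp only [biEval, igusaForm, map_sum, map_mul, eval_rename, Sum.elim_comp_inl,
    Sum.elim_comp_inr]

/-- Leibniz produces four sums, one for each factor replaced by `y`. Translating `ρ` by an element
of `T` permutes the factors, so the four sums agree. -/
theorem eval_mkDerivation_quartic (u y : Two g → ℂ) (T : SmallSubgroup g) (α β : Two g)
    (hT : (T.1 : Set (Two g)) = {0, α, β, α + β}) :
    eval u (mkDerivation ℂ (fun σ => (C (y σ) : Poly g)) (quartic T)) =
      4 * ∑ ρ, y ρ * u (ρ + α) * u (ρ + β) * u (ρ + α + β) := by
  have hreindex : ∀ (γ : Two g) (f : Two g → ℂ), ∑ ρ, f (ρ + γ) = ∑ ρ, f ρ := fun γ f =>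
    Equiv.sum_comp (Equiv.addRight γ) f
  have hs : ∀ v : Two g, v + v = 0 := two_add_self
  rw [quartic_eq T α β hT]
  simp only [map_sum, Derivation.leibniz, mkDerivation_X, smul_eq_mul, map_add, map_mul, eval_X,
    eval_C]
  set f : Two g → ℂ := fun ρ => y ρ * u (ρ + α) * u (ρ + β) * u (ρ + α + β) with hf
  have h : ∀ ρ, u ρ * u (ρ + α) * u (ρ + β) * y (ρ + α + β) + u (ρ + α + β) *
      (u ρ * u (ρ + α) * y (ρ + β) + u (ρ + β) * (u ρ * y (ρ + α) + u (ρ + α) * y ρ)) =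
      f ρ + f (ρ + α) + f (ρ + β) + f (ρ + (α + β)) := by
    intro ρ
    have e1 : ρ + β + α = ρ + α + β := by abel
    have e5 : ρ + α + α = ρ := by rw [add_assoc, hs, add_zero]
    have e6 : ρ + β + β = ρ := by rw [add_assoc, hs, add_zero]
    have e7 : ρ + α + β + β = ρ + α := by rw [add_assoc, hs, add_zero]
    have e8 : ρ + α + β + α = ρ + β := by rw [add_right_comm, e5]
    simp only [hf, ← add_assoc ρ α β, e1, e5, e6, e7, e8]
    ring
  rw [Finset.sum_congr rfl fun ρ _ => h ρ]
  simp only [Finset.sum_add_distrib, hreindex]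
  ring

theorem biEval_igusaForm_eq_zero {R : PPoly g} (h0 : evalQuartics g R = 0) (u x y : Two g → ℂ)
    (h : ∀ α β : Two g, ∑ ρ, x ρ * x (ρ + α) * x (ρ + β) * x (ρ + α + β) =
      ∑ ρ, y ρ * u (ρ + α) * u (ρ + β) * u (ρ + α + β)) :
    biEval u x (igusaForm R) = 0 := by
  have hD := congrArg (eval u)
    (derivation_aeval_eq_sum (mkDerivation ℂ (fun σ => (C (y σ) : Poly g))) quartic R)
  rw [show aeval quartic R = 0 from h0, map_zero, map_zero, map_sum] at hD
  rw [biEval_igusaForm]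
  refine (mul_eq_zero.1 (?_ : (4 : ℂ) * _ = 0)).resolve_left (by norm_num)
  rw [Finset.mul_sum, hD]
  refine Finset.sum_congr rfl fun T _ => ?_
  obtain ⟨α, β, hT⟩ := exists_generators T
  rw [map_mul, eval_mkDerivation_quartic u y T α β hT, ← h α β, quartic_eq T α β hT]
  simp only [map_sum, map_mul, eval_X, evalQuartics]
  ring

/-- Bihomogeneity makes the vanishing locus a basic closed set, so it contains the closure of the
image. -/
theorem mem_universalKummerIdeal {F : BiPoly g} {a b : ℕ} (hF : IsBihomogeneous F a b)
    (h : ∀ p ∈ thetaImage g, VanishesAt F p) : F ∈ universalKummerIdeal g := by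
  let _ := zariskiTopology g
  have hc : IsClosed {p | VanishesAt F p} := by
    rw [← isOpen_compl_iff]
    exact TopologicalSpace.isOpen_generateFrom_of_mem ⟨F, a, b, hF, rfl⟩
  exact fun p hp => closure_minimal h hc hp

end UniversalKummer

/-! ### Convergence tools: product series, Gaussians, positive definite forms. -/

theorem summable_prod_apply {ι κ : Type*} [Fintype ι] {f : ι → κ → ℝ} (hf : ∀ i, Summable (f i))
    (h0 : ∀ i k, 0 ≤ f i k) : Summable fun n : ι → κ => ∏ i, f i (n i) := by
  classical
  refine summable_of_sum_le (c := ∏ i, ∑' k, f i k)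
    (fun n => Finset.prod_nonneg fun i _ => h0 i _) fun s => ?_
  calc ∑ n ∈ s, ∏ i, f i (n i)
      -- A finite set lies in the box of its coordinate projections, over which the sum factors.
      ≤ ∑ n ∈ Fintype.piFinset fun i => s.image (· i), ∏ i, f i (n i) := by
        refine Finset.sum_le_sum_of_subset_of_nonneg (fun n hn => ?_)
          fun n _ _ => Finset.prod_nonneg fun i _ => h0 i _
        exact Fintype.mem_piFinset.2 fun i => Finset.mem_image_of_mem _ hn
    _ = ∏ i, ∑ k ∈ s.image (· i), f i k := (Finset.prod_univ_sum _ _).symm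
    _ ≤ ∏ i, ∑' k, f i k :=
        Finset.prod_le_prod (fun i _ => Finset.sum_nonneg fun k _ => h0 i k)
          fun i _ => (hf i).sum_le_tsum _ fun k _ => h0 i k

theorem summable_exp_neg_sq_add_linear {c : ℝ} (hc : 0 < c) (y : ℝ) :
    Summable fun n : ℤ => Real.exp (-Real.pi * n ^ 2 * c - 2 * Real.pi * n * y) := by
  have h := ((summable_jacobiTheta₂_term_iff (y * Complex.I) (c * Complex.I)).2
    (by simpa using hc)).norm
  simpa [norm_jacobiTheta₂_term] using h

theorem Matrix.PosDef.exists_pos_mul_sum_sq_le {ι : Type*} [Fintype ι] {Y : Matrix ι ι ℝ}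
    (hY : Y.PosDef) : ∃ c > 0, ∀ v : ι → ℝ, c * ∑ i, v i ^ 2 ≤ v ⬝ᵥ Y.mulVec v := by
  let q : EuclideanSpace ℝ ι → ℝ := fun v => v.ofLp ⬝ᵥ Y.mulVec v.ofLp
  have hq : Continuous q := by
    simp only [q, dotProduct, Matrix.mulVec]
    fun_prop
  have hpos : ∀ v, v ≠ 0 → 0 < q v := fun v hv => by
    have := hY.dotProduct_mulVec_pos (x := v.ofLp) (by simpa using hv)
    simpa using this
  obtain ⟨c, hc, h⟩ : ∃ c > 0, ∀ v ∈ Metric.sphere (0 : EuclideanSpace ℝ ι) 1, c ≤ q v := by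
    -- The sphere is empty when `ι` is, which covers `g = 0`.
    rcases (Metric.sphere (0 : EuclideanSpace ℝ ι) 1).eq_empty_or_nonempty with he | hne
    · exact ⟨1, one_pos, by simp [he]⟩
    · obtain ⟨v, hv, hmin⟩ := (isCompact_sphere (0 : EuclideanSpace ℝ ι) 1).exists_isMinOn hne
        hq.continuousOn
      exact ⟨q v, hpos v (by rintro rfl; simp at hv), fun w hw => hmin hw⟩
  refine ⟨c, hc, fun v => ?_⟩
  by_cases hv : v = 0
  · simp [hv]
  obtain ⟨w, rfl⟩ : ∃ w : EuclideanSpace ℝ ι, w.ofLp = v := ⟨WithLp.toLp 2 v, rfl⟩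
  have hw : 0 < ‖w‖ := norm_pos_iff.2 (by simpa using hv)
  have h1 := h (‖w‖⁻¹ • w) (by simp [norm_smul, hw.ne'])
  have h2 : q (‖w‖⁻¹ • w) = (‖w‖ ^ 2)⁻¹ * (w.ofLp ⬝ᵥ Y.mulVec w.ofLp) := by
    simp only [q, WithLp.ofLp_smul, Matrix.mulVec_smul, dotProduct_smul, smul_dotProduct,
      smul_eq_mul]
    ring
  have h3 : ‖w‖ ^ 2 = ∑ i, w i ^ 2 := by simp [EuclideanSpace.norm_sq_eq]
  rw [h2, inv_mul_eq_div, le_div_iff₀ (by positivity), h3] at h1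
  exact h1

/-! ### Second order theta functions as sums over residue classes of `ℤ^g`. -/

namespace UniversalKummer

variable {g : ℕ}

/-- The exponential term of a second order theta series, as a function of `a = 2 n + σ ∈ ℤ^g`. -/
noncomputable def thetaTerm (τ : Matrix (Fin g) (Fin g) ℂ) (z : Fin g → ℂ) (a : Fin g → ℤ) : ℂ :=
  Complex.exp (Real.pi * Complex.I / 2 * ((fun i => (a i : ℂ)) ⬝ᵥ τ.mulVec fun i => (a i : ℂ)) +
    2 * Real.pi * Complex.I * ((fun i => (a i : ℂ)) ⬝ᵥ z))

/-- Each term is dominated by a product of one-variable Gaussians. The factor `π i / 2` in the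
exponent accounts for `c / 2`. -/
theorem summable_norm_thetaTerm {τ : Matrix (Fin g) (Fin g) ℂ} (hτ : τ ∈ SiegelUpperHalfSpace g)
    (z : Fin g → ℂ) : Summable fun a => ‖thetaTerm τ z a‖ := by
  obtain ⟨c, hc, hle⟩ := hτ.2.exists_pos_mul_sum_sq_le
  refine Summable.of_nonneg_of_le (fun _ => norm_nonneg _) (fun a => ?_)
    (summable_prod_apply (fun i => summable_exp_neg_sq_add_linear (half_pos hc) (z i).im)
      fun i n => (Real.exp_pos _).le)
  rw [thetaTerm, Complex.norm_exp, ← Real.exp_sum, Real.exp_le_exp]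
  have h1 : ((fun i => (a i : ℂ)) ⬝ᵥ τ.mulVec fun i => (a i : ℂ)).im =
      (fun i => (a i : ℝ)) ⬝ᵥ (τ.map Complex.im).mulVec fun i => (a i : ℝ) := by
    simp [dotProduct, Matrix.mulVec]
  have h2 : ((fun i => (a i : ℂ)) ⬝ᵥ z).im = ∑ i, (a i : ℝ) * (z i).im := by
    simp [dotProduct]
  have h3 := hle fun i => (a i : ℝ)
  rw [← h1] at h3
  have h4 : (Real.pi * Complex.I / 2 * ((fun i => (a i : ℂ)) ⬝ᵥ τ.mulVec fun i => (a i : ℂ)) +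
      2 * Real.pi * Complex.I * ((fun i => (a i : ℂ)) ⬝ᵥ z)).re =
      -(Real.pi / 2 * ((fun i => (a i : ℂ)) ⬝ᵥ τ.mulVec fun i => (a i : ℂ)).im) -
        2 * Real.pi * ((fun i => (a i : ℂ)) ⬝ᵥ z).im := by
    generalize ((fun i => (a i : ℂ)) ⬝ᵥ τ.mulVec fun i => (a i : ℂ)) = A
    generalize ((fun i => (a i : ℂ)) ⬝ᵥ z) = B
    rw [show (Real.pi * Complex.I / 2 * A + 2 * Real.pi * Complex.I * B : ℂ) =
      ((Real.pi / 2 : ℝ) : ℂ) * (Complex.I * A) + ((2 * Real.pi : ℝ) : ℂ) * (Complex.I * B) by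
        push_cast; ring]
    simp only [Complex.add_re, Complex.re_ofReal_mul, Complex.I_mul_re]
    ring
  rw [h4, h2, Finset.sum_sub_distrib]
  have h5 : ∑ i, -Real.pi * (a i : ℝ) ^ 2 * (c / 2) =
      -(Real.pi / 2 * (c * ∑ i, (a i : ℝ) ^ 2)) := by
    rw [Finset.mul_sum, Finset.mul_sum, ← Finset.sum_neg_distrib]
    exact Finset.sum_congr rfl fun i _ => by ring
  have h6 : ∑ i, 2 * Real.pi * (a i : ℝ) * (z i).im =
      2 * Real.pi * ∑ i, (a i : ℝ) * (z i).im := by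
    rw [Finset.mul_sum]
    exact Finset.sum_congr rfl fun i _ => by ring
  rw [h5, h6]
  have := mul_le_mul_of_nonneg_left h3 (by positivity : 0 ≤ Real.pi / 2)
  linarith

/-- The reduction of `a ∈ ℤ^g` modulo two. -/
def modTwo (a : Fin g → ℤ) : Two g := fun i => (a i : ZMod 2)

theorem modTwo_sub (a b : Fin g → ℤ) : modTwo (a - b) = modTwo a + modTwo b := by
  funext i; simp [modTwo, sub_eq_add_neg]

/-- The terms of the theta series `Θ[σ]`, extended by zero to all of `ℤ^g`. -/
noncomputable def classTerm (τ : Matrix (Fin g) (Fin g) ℂ) (z : Fin g → ℂ) (σ : Two g) (a : Fin g → ℤ) : ℂ :=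
  if modTwo a = σ then thetaTerm τ z a else 0

theorem secondTheta_eq_tsum (τ : Matrix (Fin g) (Fin g) ℂ) (z : Fin g → ℂ) (σ : Two g) :
    secondTheta τ z σ = ∑' a, classTerm τ z σ a := by
  let φ : (Fin g → ℤ) → (Fin g → ℤ) := fun n i => 2 * n i + ((σ i).val : ℤ)
  have hφ : Function.Injective φ := fun m n h => by
    funext i
    have := congrFun h i
    simp only [φ] at this
    omega
  have h2 : ((2 : ℤ) : ZMod 2) = 0 := by decide
  have hmod : ∀ n, modTwo (φ n) = σ := fun n => by
    funext i
    simp only [modTwo, φ, Int.cast_add, Int.cast_mul, h2, zero_mul, zero_add, Int.cast_natCast,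
      ZMod.natCast_zmod_val]
  have hsupp : Function.support (classTerm τ z σ) ⊆ Set.range φ := by
    intro a ha
    have hσ : modTwo a = σ := by
      by_contra h
      exact ha (by simp [classTerm, h])
    refine ⟨fun i => (a i - ((σ i).val : ℤ)) / 2, funext fun i => ?_⟩
    have hd : (2 : ℤ) ∣ a i - ((σ i).val : ℤ) := by
      rw [← hσ]
      have := (ZMod.intCast_zmod_eq_zero_iff_dvd (a i - ((modTwo a i).val : ℤ)) 2).1
      refine this ?_
      simp [modTwo]
    simp only [φ]
    omega
  rw [← hφ.tsum_eq hsupp, secondTheta, theta]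
  refine tsum_congr fun n => ?_
  rw [classTerm, if_pos (hmod n), thetaTerm]
  have hv : ((fun i => (n i : ℂ)) + halfChar σ) = (1 / 2 : ℂ) • fun i => ((φ n i : ℤ) : ℂ) := by
    funext i
    simp only [halfChar, φ, Pi.add_apply, Pi.smul_apply, smul_eq_mul]
    push_cast
    ring
  have h0 : halfChar (0 : Two g) = 0 := by
    funext i
    simp [halfChar]
  simp only [hv, h0, add_zero, Matrix.smul_mulVec, Matrix.mulVec_smul, dotProduct_smul,
    smul_dotProduct, smul_eq_mul]
  congr 1
  ring

theorem summable_norm_classTerm {τ : Matrix (Fin g) (Fin g) ℂ} (hτ : τ ∈ SiegelUpperHalfSpace g)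
    (z : Fin g → ℂ) (σ : Two g) : Summable fun a => ‖classTerm τ z σ a‖ := by
  refine Summable.of_nonneg_of_le (fun _ => norm_nonneg _) (fun a => ?_)
    (summable_norm_thetaTerm hτ z)
  unfold classTerm
  split_ifs <;> simp

/-! ### The quartic Riemann relation. -/

/-- Quadruples of lattice vectors. -/
abbrev Quad (g : ℕ) : Type :=
  ((Fin g → ℤ) × (Fin g → ℤ)) × ((Fin g → ℤ) × (Fin g → ℤ))

/-- The quadruples with reductions `(ρ, ρ + α, ρ + β, ρ + α + β)` for some `ρ`. -/
def quadLattice (α β : Two g) : Set (Quad g) :=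
  {a | modTwo a.1.2 = modTwo a.1.1 + α ∧ modTwo a.2.1 = modTwo a.1.1 + β ∧
    modTwo a.2.2 = modTwo a.1.1 + α + β}

theorem tsum_mul_four {ι : Type*} {f₁ f₂ f₃ f₄ : ι → ℂ} (h₁ : Summable fun a => ‖f₁ a‖)
    (h₂ : Summable fun a => ‖f₂ a‖) (h₃ : Summable fun a => ‖f₃ a‖)
    (h₄ : Summable fun a => ‖f₄ a‖) :
    Summable (fun a : (ι × ι) × (ι × ι) => f₁ a.1.1 * f₂ a.1.2 * (f₃ a.2.1 * f₄ a.2.2)) ∧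
    (∑' a, f₁ a) * (∑' a, f₂ a) * (∑' a, f₃ a) * (∑' a, f₄ a) =
      ∑' a : (ι × ι) × (ι × ι), f₁ a.1.1 * f₂ a.1.2 * (f₃ a.2.1 * f₄ a.2.2) := by
  have h₁₂ := h₁.mul_norm h₂
  have h₃₄ := h₃.mul_norm h₄
  refine ⟨(h₁₂.mul_norm h₃₄).of_norm, ?_⟩
  rw [mul_assoc, tsum_mul_tsum_of_summable_norm h₁ h₂, tsum_mul_tsum_of_summable_norm h₃ h₄,
    tsum_mul_tsum_of_summable_norm (f := fun x : ι × ι => f₁ x.1 * f₂ x.2)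
      (g := fun x : ι × ι => f₃ x.1 * f₄ x.2) h₁₂ h₃₄]

/-- Each quadruple contributes for at most one `ρ`, the reduction of its first vector. Separate
arguments `z` and `w` let this serve both sides of the Riemann relation. -/
theorem sum_secondTheta_mul {τ : Matrix (Fin g) (Fin g) ℂ} (hτ : τ ∈ SiegelUpperHalfSpace g)
    (z w : Fin g → ℂ) (α β : Two g) :
    ∑ ρ, secondTheta τ z ρ * secondTheta τ w (ρ + α) * secondTheta τ w (ρ + β) *
      secondTheta τ w (ρ + α + β) =
    ∑' a : Quad g, (quadLattice α β).indicator (fun a => thetaTerm τ z a.1.1 *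
      thetaTerm τ w a.1.2 * (thetaTerm τ w a.2.1 * thetaTerm τ w a.2.2)) a := by
  have h := fun ρ => tsum_mul_four (summable_norm_classTerm hτ z ρ)
    (summable_norm_classTerm hτ w (ρ + α)) (summable_norm_classTerm hτ w (ρ + β))
    (summable_norm_classTerm hτ w (ρ + α + β))
  simp only [secondTheta_eq_tsum]
  rw [Finset.sum_congr rfl fun ρ _ => (h ρ).2, ← Summable.tsum_finsetSum fun ρ _ => (h ρ).1]
  refine tsum_congr fun a => ?_
  classical
  rw [Finset.sum_eq_single (modTwo a.1.1)]
  · simp only [classTerm, Set.indicator_apply, quadLattice, Set.mem_ofPred_eq, if_true]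
    split_ifs <;> first | rfl | tauto | simp
  · intro ρ _ hρ
    simp [classTerm, hρ.symm]
  · simp

/-- The map `a ↦ b` with `2 b = (a₁ + a₂ + a₃ + a₄, a₁ + a₂ - a₃ - a₄, a₁ - a₂ + a₃ - a₄,
a₁ - a₂ - a₃ + a₄)`. -/
def quadMap (a : Quad g) : Quad g :=
  let b : Fin g → ℤ := fun i => (a.1.1 i + a.1.2 i + a.2.1 i + a.2.2 i) / 2
  ((b, b - a.2.1 - a.2.2), (b - a.1.2 - a.2.2, b - a.1.2 - a.2.1))

theorem two_mul_quadMap {α β : Two g} {a : Quad g} (ha : a ∈ quadLattice α β) (i : Fin g) :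
    2 * (quadMap a).1.1 i = a.1.1 i + a.1.2 i + a.2.1 i + a.2.2 i := by
  refine Int.mul_ediv_cancel' ((ZMod.intCast_zmod_eq_zero_iff_dvd _ 2).1 ?_)
  have h1 := congrFun ha.1 i
  have h2 := congrFun ha.2.1 i
  have h3 := congrFun ha.2.2 i
  simp only [modTwo, Pi.add_apply] at h1 h2 h3
  -- The four reductions add up to `4ρ + 2α + 2β = 0`.
  push_cast
  rw [h1, h2, h3]
  generalize (a.1.1 i : ZMod 2) = x
  generalize α i = y
  generalize β i = w
  revert x y w
  decide

theorem quadMap_mem {α β : Two g} {a : Quad g} (ha : a ∈ quadLattice α β) :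
    quadMap a ∈ quadLattice α β := by
  obtain ⟨h1, h2, h3⟩ := ha
  simp only [quadLattice, quadMap, Set.mem_ofPred_eq, modTwo_sub, h1, h2, h3]
  generalize modTwo a.1.1 = x
  generalize modTwo _ = b
  refine ⟨?_, ?_, ?_⟩ <;> funext i <;> simp only [Pi.add_apply] <;>
    generalize x i = x <;> generalize b i = b <;> generalize α i = y <;> generalize β i = w <;>
    revert x b y w <;> decide

/-- The underlying matrix is half a symmetric Hadamard matrix of order four, so its square is the
identity. -/
theorem quadMap_quadMap {α β : Two g} {a : Quad g} (ha : a ∈ quadLattice α β) :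
    quadMap (quadMap a) = a := by
  have h := two_mul_quadMap ha
  have h' := two_mul_quadMap (quadMap_mem ha)
  have e : ∀ c : Quad g, quadMap c = (((quadMap c).1.1, (quadMap c).1.1 - c.2.1 - c.2.2),
    ((quadMap c).1.1 - c.1.2 - c.2.2, (quadMap c).1.1 - c.1.2 - c.2.1)) := fun c => rfl
  have e2 : (quadMap a).1.2 = (quadMap a).1.1 - a.2.1 - a.2.2 := rfl
  have e3 : (quadMap a).2.1 = (quadMap a).1.1 - a.1.2 - a.2.2 := rfl
  have e4 : (quadMap a).2.2 = (quadMap a).1.1 - a.1.2 - a.2.1 := rfl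
  rw [e (quadMap a)]
  refine Prod.ext (Prod.ext ?_ ?_) (Prod.ext ?_ ?_) <;> funext i <;>
    have hi := h i <;> have hi' := h' i <;>
    simp only [e2, e3, e4, Pi.sub_apply] at hi' ⊢ <;> omega

/-- Orthogonality preserves the sum of the four quadratic terms. The linear terms add up to `(a₁ +
a₂ + a₃ + a₄) · z = b₁ · 2z`, so the whole argument moves to the first factor. -/
theorem thetaTerm_quadMap {α β : Two g} {a : Quad g} (ha : a ∈ quadLattice α β)
    (τ : Matrix (Fin g) (Fin g) ℂ) (z : Fin g → ℂ) :
    thetaTerm τ ((2 : ℂ) • z) (quadMap a).1.1 * thetaTerm τ 0 (quadMap a).1.2 *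
      (thetaTerm τ 0 (quadMap a).2.1 * thetaTerm τ 0 (quadMap a).2.2) =
    thetaTerm τ z a.1.1 * thetaTerm τ z a.1.2 * (thetaTerm τ z a.2.1 * thetaTerm τ z a.2.2) := by
  have h := two_mul_quadMap ha
  obtain ⟨⟨a₁, a₂⟩, a₃, a₄⟩ := a
  have e : quadMap ((a₁, a₂), (a₃, a₄)) = (((quadMap ((a₁, a₂), (a₃, a₄))).1.1,
    (quadMap ((a₁, a₂), (a₃, a₄))).1.1 - a₃ - a₄),
    ((quadMap ((a₁, a₂), (a₃, a₄))).1.1 - a₂ - a₄,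
      (quadMap ((a₁, a₂), (a₃, a₄))).1.1 - a₂ - a₃)) := rfl
  rw [e]
  generalize (quadMap ((a₁, a₂), (a₃, a₄))).1.1 = b at h
  let c : (Fin g → ℤ) → (Fin g → ℂ) := fun n i => (n i : ℂ)
  have hsub : ∀ m n, (fun i => (((m - n) i : ℤ) : ℂ)) = c m - c n := fun m n => by
    funext i; simp [c]
  have hc : ∀ n : Fin g → ℤ, (fun i => (n i : ℂ)) = c n := fun n => rfl
  have ha₁ : c a₁ = (2 : ℂ) • c b - c a₂ - c a₃ - c a₄ := by
    funext i
    have := congrArg (Int.cast : ℤ → ℂ) (h i)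
    push_cast at this
    simp only [c, Pi.sub_apply, Pi.smul_apply, smul_eq_mul]
    rw [this]
    ring
  have hc_sub : ∀ m n, c (m - n) = c m - c n := hsub
  simp only [thetaTerm, ← Complex.exp_add]
  congr 1
  simp only [hc, hc_sub, ha₁, Matrix.mulVec_sub, Matrix.mulVec_smul, dotProduct_sub,
    sub_dotProduct, dotProduct_smul, smul_dotProduct, smul_eq_mul, dotProduct_zero]
  ring

/-- A quartic Riemann relation for the second order theta functions. -/
theorem sum_secondTheta_quartic {τ : Matrix (Fin g) (Fin g) ℂ} (hτ : τ ∈ SiegelUpperHalfSpace g)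
    (z : Fin g → ℂ) (α β : Two g) :
    ∑ ρ, secondTheta τ z ρ * secondTheta τ z (ρ + α) * secondTheta τ z (ρ + β) *
      secondTheta τ z (ρ + α + β) =
    ∑ ρ, secondTheta τ ((2 : ℂ) • z) ρ * secondTheta τ 0 (ρ + α) * secondTheta τ 0 (ρ + β) *
      secondTheta τ 0 (ρ + α + β) := by
  rw [sum_secondTheta_mul hτ, sum_secondTheta_mul hτ, ← tsum_subtype, ← tsum_subtype]
  let e : quadLattice α β ≃ quadLattice α β :=
    { toFun := fun a => ⟨quadMap a, quadMap_mem a.2⟩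
      invFun := fun a => ⟨quadMap a, quadMap_mem a.2⟩
      left_inv := fun a => Subtype.ext (quadMap_quadMap a.2)
      right_inv := fun a => Subtype.ext (quadMap_quadMap a.2) }
  refine (tsum_congr fun a => (thetaTerm_quadMap a.2 τ z).symm).trans ?_
  exact e.tsum_eq fun a : quadLattice α β => thetaTerm τ ((2 : ℂ) • z) a.1.1.1 *
    thetaTerm τ 0 a.1.1.2 * (thetaTerm τ 0 a.1.2.1 * thetaTerm τ 0 a.1.2.2)

end UniversalKummer

/-! ### Conclusion, for arbitrary homogeneous coordinates. -/

namespace UniversalKummer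

variable {g : ℕ}

theorem biEval_igusaForm_smul_secondTheta {R : PPoly g} (h0 : evalQuartics g R = 0)
    {τ : Matrix (Fin g) (Fin g) ℂ} (hτ : τ ∈ SiegelUpperHalfSpace g) (z : Fin g → ℂ) {c : ℂ}
    (hc : c ≠ 0) (k : ℂ) :
    biEval (c • secondTheta τ 0) (k • secondTheta τ z) (igusaForm R) = 0 := by
  -- The quartics in `x` scale by `k ^ 4` and the three factors `u` by `c ^ 3`; the direction `y`
  -- absorbs the quotient.
  refine biEval_igusaForm_eq_zero h0 _ _ ((k ^ 4 / c ^ 3) • secondTheta τ ((2 : ℂ) • z))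
    fun α β => ?_
  have h := congrArg (k ^ 4 * ·) (sum_secondTheta_quartic hτ z α β)
  simp only [Finset.mul_sum] at h
  simp only [Pi.smul_apply, smul_eq_mul]
  convert h using 2 with ρ _ ρ
  · ring
  · field_simp

end UniversalKummer

theorem proposition3p4 (g d : ℕ) (R : UniversalKummer.PPoly g)
    (hR : UniversalKummer.IsGeneralizedIgusaEquation g d R) :
    UniversalKummer.IsBihomogeneous (UniversalKummer.igusaForm R) (4 * (d - 1)) 4 ∧
    UniversalKummer.igusaForm R ∈ UniversalKummer.universalKummerIdeal g ∧
    (∀ τ ∈ UniversalKummer.SiegelUpperHalfSpace g, ∀ z : Fin g → ℂ,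
      UniversalKummer.biEval (UniversalKummer.secondTheta τ 0) (UniversalKummer.secondTheta τ z)
        (UniversalKummer.igusaForm R) = 0) ∧
    UniversalKummer.restrictDiagonal (UniversalKummer.igusaForm R) = 0 := by
  obtain ⟨hd, h0⟩ := hR
  have hb := UniversalKummer.igusaForm_isBihomogeneous hd
  refine ⟨hb, UniversalKummer.mem_universalKummerIdeal hb ?_, fun τ hτ z => ?_,
    UniversalKummer.restrictDiagonal_igusaForm hd h0⟩
  · rintro _ ⟨τ, hτ, z, h₁, h₂, rfl⟩ u x hu hx hu' hx'
    obtain ⟨c, rfl⟩ := (Projectivization.mk_eq_mk_iff' ℂ _ _ hu h₁).1 hu'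
    obtain ⟨k, rfl⟩ := (Projectivization.mk_eq_mk_iff' ℂ _ _ hx h₂).1 hx'
    exact UniversalKummer.biEval_igusaForm_smul_secondTheta h0 hτ z (left_ne_zero_of_smul hu) k
  · simpa using UniversalKummer.biEval_igusaForm_smul_secondTheta h0 hτ z one_ne_zero 1
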